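/- Let $\mathbb I=[0,1]$, let $f:\mathbb I\to\mathbb I$ be the doubling map, $f(x)=2x$ for $0\le x\le \tfrac12$ and $f(x)=2x-1$ for $\tfrac12<x\le 1$, and put $\tau(x)=1$ for $0\le x\le\tfrac12$, $\tau(x)=2$ for $\tfrac12<x\le1$. For maps $g_1,g_2:\mathbb I\to\mathbb I$, $x\in\mathbb I$ and $n\ge 0$ write $$g_x^n=g_{\tau(f^{n-1}(x))}\circ\cdots\circ g_{\tau(f(x))}\circ g_{\tau(x)},\qquad g_x^0=\mathrm{id}.$$ (a) Let $\beta_1,\beta_2\in(0,1)$ with $\beta_1\neq\beta_2$, and let $g_1,g_2$ be strictly increasing $C^2$ diffeomorphisms of $\mathbb I$ with $g_i(0)=0$, $g_i(1)=1$, $g_i(\beta_i)=\beta_i$ $(i=1,2)$ such that $g_1(y)<y$ for $0<y<\beta_1$, $g_1(y)>y$ for $\beta_1<y<1$, $g_2(y)>y$ for $0<y<\beta_2$ and $g_2(y)<y$ for $\beta_2<y<1$. Suppose that both normal Lyapunov exponents $$L(j)=\tfrac12\ln g_1'(j)+\tfrac12\ln g_2'(j),\qquad j=0,1,$$ are negative.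 Then there is a measurable function $\Phi:\mathbb I\to\mathbb I$ such that for Lebesgue-almost every $x\in\mathbb I$ and every $y\in\mathbb I$, $$\lim_{n\to\infty}g_x^n(y)=\begin{cases}0 & \text{if } y<\Phi(x),\\ 1 & \text{if } y>\Phi(x).\end{cases}$$ (b) In particular, the same conclusion holds for the cubic family $g_1(y)=y+y(1-y)(y-\beta_1)$, $g_2(y)=y-y(1-y)(y-\beta_2)$ whenever $\beta_1\ne\beta_2$ and $(\beta_1,\beta_2)\in\Gamma_S$, where $$\Gamma_S=\Bigl\{(\beta_1,\beta_2):\ \beta_1,\beta_2\in(0,1),\ 2-\tfrac1{\beta_1}<\beta_2<\tfrac1{1-\beta_1}-1\Bigr\}.$$ -/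

import Mathlib

open Set Filter Topology MeasureTheory

namespace RandomWalkBoundary

/-- The doubling map `f` of `[0,1]`: `2x` for `x ≤ 1/2` and `2x - 1` for `x > 1/2`. -/
noncomputable def doubling (x : ℝ) : ℝ :=
  if x ≤ 1 / 2 then 2 * x else 2 * x - 1

/-- The fiber map over the base point `x`: it is `g₁` if `x ≤ 1/2` (symbol 1) and `g₂` if
`x > 1/2` (symbol 2). -/
noncomputable def fiberMap (g₁ g₂ : ℝ → ℝ) (x : ℝ) : ℝ → ℝ :=
  if x ≤ 1 / 2 then g₁ else g₂

/-- `fiberIter g₁ g₂ n x y` is the composition of the fiber maps over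
`x, f x, …, f^(n-1) x` (the one over `x` is applied first), evaluated at `y`. -/
noncomputable def fiberIter (g₁ g₂ : ℝ → ℝ) : ℕ → ℝ → ℝ → ℝ
  | 0, _, y => y
  | n + 1, x, y => fiberMap g₁ g₂ (doubling^[n] x) (fiberIter g₁ g₂ n x y)

/-- `g` restricts to a strictly increasing `C²` diffeomorphism of `[0,1]` (the inverse is `C²`
because the derivative does not vanish; at the end points derivatives are one-sided). -/
structure IsIncreasingDiffeo (g : ℝ → ℝ) : Prop where
  bijOn : BijOn g (Icc 0 1) (Icc 0 1)
  strictMonoOn : StrictMonoOn g (Icc 0 1)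
  contDiffOn : ContDiffOn ℝ 2 g (Icc 0 1)
  derivWithin_pos : ∀ y ∈ Icc (0 : ℝ) 1, 0 < derivWithin g (Icc 0 1) y

/-- The conditions on the pair of fiber maps: both are increasing `C²` diffeomorphisms of `[0,1]`
that fix `0`, `1` and their own parameter `βᵢ ∈ (0,1)`; on `(0,1)`, the map `g₁` moves points away
from `β₁`, and `g₂` moves points towards `β₂`. -/
structure IsFiberPair (β₁ β₂ : ℝ) (g₁ g₂ : ℝ → ℝ) : Prop where
  param₁ : β₁ ∈ Ioo (0 : ℝ) 1
  param₂ : β₂ ∈ Ioo (0 : ℝ) 1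
  diffeo₁ : IsIncreasingDiffeo g₁
  diffeo₂ : IsIncreasingDiffeo g₂
  zero₁ : g₁ 0 = 0
  zero₂ : g₂ 0 = 0
  one₁ : g₁ 1 = 1
  one₂ : g₂ 1 = 1
  fixed₁ : g₁ β₁ = β₁
  fixed₂ : g₂ β₂ = β₂
  lt₁ : ∀ y, 0 < y → y < β₁ → g₁ y < y
  gt₁ : ∀ y, β₁ < y → y < 1 → y < g₁ y
  gt₂ : ∀ y, 0 < y → y < β₂ → y < g₂ y
  lt₂ : ∀ y, β₂ < y → y < 1 → g₂ y < y

/-- The normal Lyapunov exponent `½ log g₁'(y) + ½ log g₂'(y)` at a common fixed point `y` of the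
two fiber maps (used at `y = 0` and `y = 1`). -/
noncomputable def normalExponent (g₁ g₂ : ℝ → ℝ) (y : ℝ) : ℝ :=
  1 / 2 * Real.log (derivWithin g₁ (Icc 0 1) y) + 1 / 2 * Real.log (derivWithin g₂ (Icc 0 1) y)

/-- The first map of the cubic family. -/
def cubic₁ (β y : ℝ) : ℝ := y + y * (1 - y) * (y - β)

/-- The second map of the cubic family. -/
def cubic₂ (β y : ℝ) : ℝ := y - y * (1 - y) * (y - β)

/-- The parameter region `Γ_S` of the cubic family. -/
def gammaS : Set (ℝ × ℝ) :=
  {β | β.1 ∈ Ioo (0 : ℝ) 1 ∧ β.2 ∈ Ioo (0 : ℝ) 1 ∧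
    2 - 1 / β.1 < β.2 ∧ β.2 < 1 / (1 - β.1) - 1}

/-- For Lebesgue-almost every `x ∈ [0,1]` and every `y ∈ [0,1]`, the fiber iterates of `y` along
the orbit of `x` tend to `0` if `y < Φ x` and to `1` if `y > Φ x`. -/
def SeparatesBasins (g₁ g₂ : ℝ → ℝ) (Φ : unitInterval → unitInterval) : Prop :=
  ∀ᵐ x : unitInterval, ∀ y : unitInterval,
    (y < Φ x → Tendsto (fun n : ℕ => fiberIter g₁ g₂ n x y) atTop (𝓝 0)) ∧
    (Φ x < y → Tendsto (fun n : ℕ => fiberIter g₁ g₂ n x y) atTop (𝓝 1))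

end RandomWalkBoundary

namespace RandomWalkBoundary

open scoped ENNReal

/-! Fix `y` and let `h y` be the Lebesgue measure of the base points whose fiber iterates of `y`
converge neither to `0` nor to `1`. The point is that `h = 0` on `[0,1]`.

Each branch of the doubling map carries half of the measure, so `h y = (h (g₁ y) + h (g₂ y)) / 2`
(`measureReal_undecided`). Near an end, a negative exponent means `a₁ * a₂ < 1` for slightly
enlarged multipliers. For small `s > 0` the distance to the end, raised to the power `s`, then
contracts on average, and Markov's inequality makes `h` small there
(`exists_forall_measureReal_undecided_le`). Since `β₁ ≠ β₂`, every point can be steered close to an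
end, so a maximum principle forces `h = 0` (`nonpos_of_mean_value`).

Hence for almost every `x` all points of a countable dense set are decided. The fiber maps are
monotone, so the supremum of the dense points attracted to `0` separates the basins. -/

theorem measurable_doubling : Measurable doubling := by
  unfold doubling
  exact Measurable.ite measurableSet_Iic (by fun_prop) (by fun_prop)

/-- The definition appends the last map; peeling off the first one instead exposes the shift of the
base point, on which all later inductions rest. -/
theorem fiberIter_succ' (g₁ g₂ : ℝ → ℝ) (n : ℕ) (x y : ℝ) :
    fiberIter g₁ g₂ (n + 1) x y = fiberIter g₁ g₂ n (doubling x) (fiberMap g₁ g₂ x y) := by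
  induction n with
  | zero => rfl
  | succ n ih =>
    rw [fiberIter, ih, fiberIter, Function.iterate_succ_apply]

theorem measurable_fiberIter (g₁ g₂ : ℝ → ℝ) (n : ℕ) (y : ℝ) :
    Measurable fun x => fiberIter g₁ g₂ n x y := by
  induction n generalizing y with
  | zero => exact measurable_const
  | succ n ih =>
    have h : (fun x => fiberIter g₁ g₂ (n + 1) x y) = fun x =>
        if x ≤ 1 / 2 then fiberIter g₁ g₂ n (doubling x) (g₁ y)
        else fiberIter g₁ g₂ n (doubling x) (g₂ y) := by
      funext x
      rw [fiberIter_succ', fiberMap]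
      split_ifs <;> rfl
    rw [h]
    exact Measurable.ite measurableSet_Iic ((ih _).comp measurable_doubling)
      ((ih _).comp measurable_doubling)

/-! ### Independence of the symbols under Lebesgue measure -/

/-- Change of variables for an affine branch of slope `2`. -/
theorem setLIntegral_affine_branch (b : ℝ) (F : ℝ → ℝ≥0∞) :
    ∫⁻ x in Ioc (b / 2) ((b + 1) / 2), F (2 * x - b) = 2⁻¹ * ∫⁻ x in Ioc 0 1, F x := by
  -- With left-open intervals both branches, `b = 0` and `b = 1`, map exactly onto `(0,1]`.
  have him : (fun x : ℝ => 2 * x - b) '' Ioc (b / 2) ((b + 1) / 2) = Ioc 0 1 := by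
    ext z
    simp only [mem_image, mem_Ioc]
    constructor
    · rintro ⟨x, ⟨h1, h2⟩, rfl⟩
      constructor <;> linarith
    · rintro ⟨h1, h2⟩
      exact ⟨(z + b) / 2, ⟨by linarith, by linarith⟩, by ring⟩
  have hder : ∀ x ∈ Ioc (b / 2) ((b + 1) / 2),
      HasDerivWithinAt (fun x : ℝ => 2 * x - b) 2 (Ioc (b / 2) ((b + 1) / 2)) x := by
    intro x _
    simpa using (((hasDerivAt_id x).const_mul 2).sub_const b).hasDerivWithinAt
  have hinj : InjOn (fun x : ℝ => 2 * x - b) (Ioc (b / 2) ((b + 1) / 2)) := by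
    intro x _ z _ h
    simp only at h
    linarith
  have h := lintegral_image_eq_lintegral_abs_deriv_mul measurableSet_Ioc hder hinj F
  have h2 : ENNReal.ofReal |(2 : ℝ)| = 2 := by norm_num
  rw [him, h2, lintegral_const_mul' _ _ (by norm_num)] at h
  rw [h, ← mul_assoc, ENNReal.inv_mul_cancel (by norm_num) (by norm_num), one_mul]

/-- The two branches of the doubling map each carry half of the Lebesgue measure on `(0,1]`. -/
theorem setLIntegral_doubling (F G : ℝ → ℝ≥0∞) :
    ∫⁻ x in Ioc 0 1, (if x ≤ 1 / 2 then F (doubling x) else G (doubling x)) =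
      2⁻¹ * (∫⁻ x in Ioc 0 1, F x) + 2⁻¹ * ∫⁻ x in Ioc 0 1, G x := by
  rw [← setLIntegral_affine_branch 0 F, ← setLIntegral_affine_branch 1 G,
    ← Ioc_union_Ioc_eq_Ioc (show (0 : ℝ) ≤ 1 / 2 by norm_num) (by norm_num),
    lintegral_union measurableSet_Ioc (Ioc_disjoint_Ioc_of_le le_rfl)]
  congr 1
  · norm_num only
    refine setLIntegral_congr_fun measurableSet_Ioc fun x hx => ?_
    simp only [doubling, if_pos hx.2, sub_zero]
  · norm_num only
    refine setLIntegral_congr_fun measurableSet_Ioc fun x hx => ?_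
    simp only [doubling, if_neg (not_le.2 hx.1)]

/-- The product of the weights `w₁`, `w₂` along the first `n` symbols of `x`. -/
noncomputable def weightProd (w₁ w₂ : ℝ≥0∞) : ℕ → ℝ → ℝ≥0∞
  | 0, _ => 1
  | n + 1, x => if x ≤ 1 / 2 then w₁ * weightProd w₁ w₂ n (doubling x)
      else w₂ * weightProd w₁ w₂ n (doubling x)

theorem measurable_weightProd (w₁ w₂ : ℝ≥0∞) (n : ℕ) : Measurable (weightProd w₁ w₂ n) := by
  induction n with
  | zero => exact measurable_const
  | succ n ih =>
    exact Measurable.ite measurableSet_Iic ((ih.comp measurable_doubling).const_mul _)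
      ((ih.comp measurable_doubling).const_mul _)

/-- The symbols are independent and equidistributed, so each step contributes the mean weight as a
factor. -/
theorem setLIntegral_weightProd (w₁ w₂ : ℝ≥0∞) (n : ℕ) :
    ∫⁻ x in Ioc 0 1, weightProd w₁ w₂ n x = (2⁻¹ * (w₁ + w₂)) ^ n := by
  induction n with
  | zero => simp [weightProd]
  | succ n ih =>
    simp only [weightProd]
    rw [setLIntegral_doubling (fun x => w₁ * weightProd w₁ w₂ n x)
      (fun x => w₂ * weightProd w₁ w₂ n x),
      lintegral_const_mul _ (measurable_weightProd _ _ _),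
      lintegral_const_mul _ (measurable_weightProd _ _ _), ih, pow_succ]
    ring

/-! ### Average contraction near an end point -/

/-- Contraction is only known where `V ≤ δ`. Bounding all weight products in advance keeps the orbit
in that region, so the one-step estimates can be chained. -/
theorem lyapunov_fiberIter_le {g₁ g₂ : ℝ → ℝ} {K : Set ℝ} (hK₁ : MapsTo g₁ K K)
    (hK₂ : MapsTo g₂ K K) {V : ℝ → ℝ≥0∞} {w₁ w₂ δ : ℝ≥0∞}
    (h₁ : ∀ y ∈ K, V y ≤ δ → V (g₁ y) ≤ w₁ * V y)
    (h₂ : ∀ y ∈ K, V y ≤ δ → V (g₂ y) ≤ w₂ * V y) (n : ℕ) (x : ℝ) {y : ℝ} (hy : y ∈ K)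
    (hδ : ∀ k, V y * weightProd w₁ w₂ k x ≤ δ) :
    V (fiberIter g₁ g₂ n x y) ≤ V y * weightProd w₁ w₂ n x := by
  induction n generalizing x y with
  | zero => simp [weightProd, fiberIter]
  | succ n ih =>
    have h0 : V y ≤ δ := by simpa [weightProd] using hδ 0
    rw [fiberIter_succ']
    by_cases hx : x ≤ 1 / 2
    · have key : ∀ k, V (g₁ y) * weightProd w₁ w₂ k (doubling x) ≤
          V y * weightProd w₁ w₂ (k + 1) x := by
        intro k
        simp only [weightProd, hx, if_true]
        calc _ ≤ (w₁ * V y) * weightProd w₁ w₂ k (doubling x) := by gcongr; exact h₁ y hy h0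
          _ = _ := by ring
      simp only [fiberMap, hx, if_true]
      exact (ih _ (hK₁ hy) fun k => (key k).trans (hδ (k + 1))).trans (key n)
    · have key : ∀ k, V (g₂ y) * weightProd w₁ w₂ k (doubling x) ≤
          V y * weightProd w₁ w₂ (k + 1) x := by
        intro k
        simp only [weightProd, hx, if_false]
        calc _ ≤ (w₂ * V y) * weightProd w₁ w₂ k (doubling x) := by gcongr; exact h₂ y hy h0
          _ = _ := by ring
      simp only [fiberMap, hx, if_false]
      exact (ih _ (hK₂ hy) fun k => (key k).trans (hδ (k + 1))).trans (key n)

/-- A Lyapunov function that contracts on average where it is small tends to zero along the fiber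
iterates with probability close to one if its initial value is small. -/
theorem mul_volume_not_tendsto_lyapunov_le {g₁ g₂ : ℝ → ℝ} {K : Set ℝ} (hK₁ : MapsTo g₁ K K)
    (hK₂ : MapsTo g₂ K K) {V : ℝ → ℝ≥0∞} {w₁ w₂ δ : ℝ≥0∞}
    (h₁ : ∀ y ∈ K, V y ≤ δ → V (g₁ y) ≤ w₁ * V y)
    (h₂ : ∀ y ∈ K, V y ≤ δ → V (g₂ y) ≤ w₂ * V y) {y : ℝ} (hy : y ∈ K) :
    δ * volume.restrict (Ioc 0 1)
      {x | ¬ Tendsto (fun n => V (fiberIter g₁ g₂ n x y)) atTop (𝓝 0)} ≤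
      V y * (1 - 2⁻¹ * (w₁ + w₂))⁻¹ := by
  have hm : Measurable fun x => ∑' n, weightProd w₁ w₂ n x :=
    Measurable.tsum fun n => measurable_weightProd w₁ w₂ n
  have hint : ∫⁻ x in Ioc 0 1, V y * ∑' n, weightProd w₁ w₂ n x =
      V y * (1 - 2⁻¹ * (w₁ + w₂))⁻¹ := by
    rw [lintegral_const_mul _ hm,
      lintegral_tsum fun n => (measurable_weightProd w₁ w₂ n).aemeasurable]
    simp_rw [setLIntegral_weightProd, ENNReal.tsum_geometric]
  rw [← hint]
  -- Markov's inequality for the weight series: where `V y` times its sum is below `δ`, every term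
  -- is below `δ`, and the terms tend to `0` and dominate `V` along the orbit.
  refine le_trans ?_ (mul_meas_ge_le_lintegral (hm.const_mul _) δ)
  refine mul_le_mul' le_rfl (measure_mono fun x hx => ?_)
  by_contra hlt
  simp only [mem_ofPred_eq, not_le] at hlt hx
  rw [← ENNReal.tsum_mul_left] at hlt
  refine hx (tendsto_of_tendsto_of_tendsto_of_le_of_le tendsto_const_nhds
    (ENNReal.tendsto_atTop_zero_of_tsum_ne_top (hlt.trans_le le_top).ne) (fun _ => zero_le)
    fun n => lyapunov_fiberIter_le hK₁ hK₂ h₁ h₂ n x hy fun k => ?_)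
  exact (ENNReal.le_tsum k).trans hlt.le

/-! ### The undecided probability and its maximum principle -/

/-- The base points for which the fiber iterates of `y` tend neither to `0` nor to `1`. -/
def undecided (g₁ g₂ : ℝ → ℝ) (y : ℝ) : Set ℝ :=
  {x | ¬ (Tendsto (fun n => fiberIter g₁ g₂ n x y) atTop (𝓝 0) ∨
    Tendsto (fun n => fiberIter g₁ g₂ n x y) atTop (𝓝 1))}

theorem measurableSet_undecided (g₁ g₂ : ℝ → ℝ) (y : ℝ) :
    MeasurableSet (undecided g₁ g₂ y) :=
  ((measurableSet_tendsto _ fun n => measurable_fiberIter g₁ g₂ n y).union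
    (measurableSet_tendsto _ fun n => measurable_fiberIter g₁ g₂ n y)).compl

theorem mem_undecided_iff (g₁ g₂ : ℝ → ℝ) (x y : ℝ) :
    x ∈ undecided g₁ g₂ y ↔ doubling x ∈ undecided g₁ g₂ (fiberMap g₁ g₂ x y) := by
  have h : ∀ l, Tendsto (fun n => fiberIter g₁ g₂ n x y) atTop l ↔
      Tendsto (fun n => fiberIter g₁ g₂ n (doubling x) (fiberMap g₁ g₂ x y)) atTop l := by
    intro l
    rw [← tendsto_add_atTop_iff_nat 1]
    simp_rw [fiberIter_succ']
  simp only [undecided, mem_ofPred_eq, h]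

theorem measureReal_undecided (g₁ g₂ : ℝ → ℝ) (y : ℝ) :
    (volume.restrict (Ioc 0 1)).real (undecided g₁ g₂ y) =
      ((volume.restrict (Ioc 0 1)).real (undecided g₁ g₂ (g₁ y)) +
        (volume.restrict (Ioc 0 1)).real (undecided g₁ g₂ (g₂ y))) / 2 := by
  have h : volume.restrict (Ioc 0 1) (undecided g₁ g₂ y) =
      2⁻¹ * volume.restrict (Ioc 0 1) (undecided g₁ g₂ (g₁ y)) +
        2⁻¹ * volume.restrict (Ioc 0 1) (undecided g₁ g₂ (g₂ y)) := by
    rw [← lintegral_indicator_one (measurableSet_undecided _ _ _),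
      ← lintegral_indicator_one (measurableSet_undecided _ _ _),
      ← lintegral_indicator_one (measurableSet_undecided _ _ _), ← setLIntegral_doubling]
    refine lintegral_congr fun x => ?_
    have hmem := mem_undecided_iff g₁ g₂ x y
    by_cases hx : x ≤ 1 / 2 <;> simp only [fiberMap, hx, if_true, if_false] at hmem ⊢ <;>
      by_cases hu : x ∈ undecided g₁ g₂ y <;> have hu' := hu <;> rw [hmem] at hu' <;>
      simp [hu, hu']
  rw [measureReal_def, h, ENNReal.toReal_add (by finiteness) (by finiteness)]
  simp [measureReal_def]
  ring

/-- If both maps preserve the interval and any point of it is sent close to the ends by some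
composition, then a bounded function with the mean value property and boundary values `0` is
nonpositive. -/
theorem nonpos_of_mean_value {g₁ g₂ h : ℝ → ℝ} (hm₁ : MapsTo g₁ (Icc 0 1) (Icc 0 1))
    (hm₂ : MapsTo g₂ (Icc 0 1) (Icc 0 1)) (hc₁ : ContinuousOn g₁ (Icc 0 1))
    (hc₂ : ContinuousOn g₂ (Icc 0 1)) (hbdd : ∀ y, h y ≤ 1)
    (hmean : ∀ y, h y = (h (g₁ y) + h (g₂ y)) / 2)
    (hend : ∀ η > 0, ∃ ε > 0, ∀ y ∈ Icc (0 : ℝ) 1, (y < ε ∨ 1 - ε < y) → h y ≤ η)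
    (hreach : ∀ ε > 0, ∀ y ∈ Icc (0 : ℝ) 1, ∃ n k : ℕ,
      g₁^[n] (g₂^[k] y) < ε ∨ 1 - ε < g₁^[n] (g₂^[k] y)) :
    ∀ y ∈ Icc (0 : ℝ) 1, h y ≤ 0 := by
  have hB : BddAbove (h '' Icc 0 1) := ⟨1, by rintro _ ⟨y, -, rfl⟩; exact hbdd y⟩
  have hne : (h '' Icc 0 1).Nonempty := ⟨h 0, mem_image_of_mem h (by simp)⟩
  set S := sSup (h '' Icc 0 1) with hS
  have hle : ∀ y ∈ Icc (0 : ℝ) 1, h y ≤ S := fun y hy => le_csSup hB (mem_image_of_mem h hy)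
  suffices hS0 : S ≤ 0 from fun y hy => (hle y hy).trans hS0
  by_contra! hpos
  obtain ⟨ε, hε, hη⟩ := hend (S / 2) (by positivity)
  -- By the mean value property the deficit `S - h` at most doubles under either map, since the
  -- deficit at the other image is nonnegative.
  have it₁ : ∀ n : ℕ, ∀ y ∈ Icc (0 : ℝ) 1, S - h (g₁^[n] y) ≤ 2 ^ n * (S - h y) := by
    intro n
    induction n with
    | zero => simp
    | succ n ih =>
      intro y hy
      rw [Function.iterate_succ_apply]
      have h1 := ih (g₁ y) (hm₁ hy)
      have h2 : S - h (g₁ y) ≤ 2 * (S - h y) := by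
        linarith [hmean y, hle (g₂ y) (hm₂ hy)]
      calc _ ≤ _ := h1
        _ ≤ 2 ^ n * (2 * (S - h y)) := by gcongr
        _ = _ := by ring
  have it₂ : ∀ n : ℕ, ∀ y ∈ Icc (0 : ℝ) 1, S - h (g₂^[n] y) ≤ 2 ^ n * (S - h y) := by
    intro n
    induction n with
    | zero => simp
    | succ n ih =>
      intro y hy
      rw [Function.iterate_succ_apply]
      have h1 := ih (g₂ y) (hm₂ hy)
      have h2 : S - h (g₂ y) ≤ 2 * (S - h y) := by
        linarith [hmean y, hle (g₁ y) (hm₁ hy)]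
      calc _ ≤ _ := h1
        _ ≤ 2 ^ n * (2 * (S - h y)) := by gcongr
        _ = _ := by ring
  -- `h` need not be continuous, so its supremum may not be attained; compactness instead makes the
  -- number of steps to an end uniform. The repeated membership fits the set predicate of the
  -- compactness induction.
  have hcpt : ∃ N : ℕ, ∀ y ∈ Icc (0 : ℝ) 1, y ∈ Icc (0 : ℝ) 1 → S / 2 ≤ 2 ^ N * (S - h y) := by
    refine isCompact_Icc.induction_on
      (p := fun s => ∃ N : ℕ, ∀ y ∈ s, y ∈ Icc (0 : ℝ) 1 → S / 2 ≤ 2 ^ N * (S - h y))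
      ⟨0, by simp⟩ ?_ ?_ ?_
    · rintro s t hst ⟨N, hN⟩
      exact ⟨N, fun y hy => hN y (hst hy)⟩
    · rintro s t ⟨N, hN⟩ ⟨M, hM⟩
      refine ⟨max N M, ?_⟩
      rintro y (hy | hy) hyI
      · refine (hN y hy hyI).trans ?_
        have := sub_nonneg.2 (hle y hyI)
        gcongr
        · norm_num
        · exact le_max_left _ _
      · refine (hM y hy hyI).trans ?_
        have := sub_nonneg.2 (hle y hyI)
        gcongr
        · norm_num
        · exact le_max_right _ _
    · intro y hy
      obtain ⟨n, k, hnk⟩ := hreach ε hε y hy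
      have hcont : ContinuousOn (fun z => g₁^[n] (g₂^[k] z)) (Icc 0 1) :=
        (hc₁.iterate hm₁ n).comp (hc₂.iterate hm₂ k) (hm₂.iterate k)
      have hev : ∀ᶠ z in 𝓝[Icc 0 1] y,
          g₁^[n] (g₂^[k] z) < ε ∨ 1 - ε < g₁^[n] (g₂^[k] z) := by
        rcases hnk with h1 | h1
        · exact ((hcont y hy).eventually_lt_const h1).mono fun _ => Or.inl
        · exact ((hcont y hy).eventually_const_lt h1).mono fun _ => Or.inr
      refine ⟨_, hev, n + k, fun z hz hzI => ?_⟩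
      have h1 := hη _ (hm₁.iterate n (hm₂.iterate k hzI)) hz
      have h2 := it₁ n _ (hm₂.iterate k hzI)
      have h3 := it₂ k _ hzI
      calc S / 2 ≤ 2 ^ n * (S - h (g₂^[k] z)) := by linarith
        _ ≤ 2 ^ n * (2 ^ k * (S - h z)) := by gcongr
        _ = _ := by ring
  obtain ⟨N, hN⟩ := hcpt
  have hpow : (0 : ℝ) < 2 ^ N := by positivity
  have : S ≤ S - S / 2 / 2 ^ N := by
    refine csSup_le hne ?_
    rintro _ ⟨y, hy, rfl⟩
    have h1 := hN y hy hy
    have h2 : S / 2 / 2 ^ N ≤ S - h y := by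
      rw [div_le_iff₀ hpow]
      linarith
    linarith
  have : 0 < S / 2 / 2 ^ N := by positivity
  linarith

/-- An orbit staying above `ε` would decrease to a fixed point in `(0, b)`, where there is none. -/
theorem exists_iterate_lt {g : ℝ → ℝ} (hm : MapsTo g (Icc 0 1) (Icc 0 1))
    (hc : ContinuousOn g (Icc 0 1)) {b : ℝ} (hb : b ≤ 1) (hlt : ∀ z, 0 < z → z < b → g z < z)
    {y ε : ℝ} (hy : y ∈ Ico 0 b) (hε : 0 < ε) : ∃ n : ℕ, g^[n] y < ε := by
  by_contra! hcon
  have hyI : y ∈ Icc (0 : ℝ) 1 := ⟨hy.1, hy.2.le.trans hb⟩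
  have hstep : ∀ n : ℕ, g^[n] y < b ∧ g^[n + 1] y < g^[n] y := by
    intro n
    induction n with
    | zero => exact ⟨hy.2, hlt _ (hε.trans_le (hcon 0)) hy.2⟩
    | succ n ih =>
      have h1 := ih.2.trans ih.1
      refine ⟨h1, ?_⟩
      rw [Function.iterate_succ_apply' g (n + 1)]
      exact hlt _ (hε.trans_le (hcon _)) h1
  have hanti : Antitone fun n => g^[n] y := antitone_nat_of_succ_le fun n => (hstep n).2.le
  have hlim := tendsto_atTop_ciInf hanti ⟨ε, by rintro _ ⟨n, rfl⟩; exact hcon n⟩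
  set l := ⨅ n, g^[n] y
  have hl1 : ε ≤ l := le_ciInf hcon
  have hl2 : l ≤ y := hanti.le_of_tendsto hlim 0
  have hlI : l ∈ Icc (0 : ℝ) 1 := ⟨hε.le.trans hl1, hl2.trans hyI.2⟩
  have hlim' : Tendsto (fun n => g^[n] y) atTop (𝓝[Icc 0 1] l) :=
    tendsto_nhdsWithin_iff.2 ⟨hlim, Eventually.of_forall fun n => hm.iterate n hyI⟩
  have h1 : Tendsto (fun n => g^[n + 1] y) atTop (𝓝 (g l)) := by
    simp_rw [Function.iterate_succ_apply']
    exact (hc l hlI).tendsto.comp hlim'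
  have h2 := tendsto_nhds_unique h1 ((tendsto_add_atTop_iff_nat 1).2 hlim)
  exact (hlt l (hε.trans_le hl1) (hl2.trans_lt hy.2)).ne h2

theorem exists_lt_iterate {g : ℝ → ℝ} (hm : MapsTo g (Icc 0 1) (Icc 0 1))
    (hc : ContinuousOn g (Icc 0 1)) {b : ℝ} (hb : 0 ≤ b) (hgt : ∀ z, b < z → z < 1 → z < g z)
    {y ε : ℝ} (hy : y ∈ Ioc b 1) (hε : 0 < ε) : ∃ n : ℕ, 1 - ε < g^[n] y := by
  have hsub : MapsTo (fun z : ℝ => 1 - z) (Icc 0 1) (Icc 0 1) := fun z hz =>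
    ⟨by linarith [hz.2], by linarith [hz.1]⟩
  have hconj : ∀ n : ℕ, (fun z => 1 - g (1 - z))^[n] (1 - y) = 1 - g^[n] y := by
    intro n
    induction n with
    | zero => rfl
    | succ n ih => rw [Function.iterate_succ_apply', Function.iterate_succ_apply', ih]; simp
  obtain ⟨n, hn⟩ := exists_iterate_lt (g := fun z => 1 - g (1 - z)) (b := 1 - b)
    (hsub.comp (hm.comp hsub))
    (continuousOn_const.sub (hc.comp (by fun_prop) hsub)) (by linarith)
    (fun z h0 h1 => by linarith [hgt (1 - z) (by linarith) (by linarith)])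
    (y := 1 - y) ⟨by linarith [hy.2], by linarith [hy.1]⟩ hε
  exact ⟨n, by rw [hconj] at hn; linarith⟩

/-- Two numbers with product less than one have power mean less than one for small exponents. -/
theorem exists_rpow_add_rpow_lt_two {a b : ℝ} (ha : 0 < a) (hb : 0 < b) (hab : a * b < 1) :
    ∃ s : ℝ, 0 < s ∧ a ^ s + b ^ s < 2 := by
  -- The sum equals `2` at `s = 0` and has slope `log (a * b) < 0` there.
  have hd : HasDerivAt (fun s : ℝ => a ^ s + b ^ s) (Real.log a + Real.log b) 0 := by
    have := (Real.hasStrictDerivAt_const_rpow ha 0).hasDerivAt.add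
      (Real.hasStrictDerivAt_const_rpow hb 0).hasDerivAt
    simp only [Real.rpow_zero, one_mul] at this
    exact this
  have hneg : Real.log a + Real.log b < 0 := by
    rw [← Real.log_mul ha.ne' hb.ne']
    exact Real.log_neg (by positivity) hab
  obtain ⟨s, hs, hs0⟩ := ((hd.tendsto_slope_zero_right.eventually_lt_const hneg).and
    self_mem_nhdsWithin).exists
  refine ⟨s, hs0, ?_⟩
  simp only [zero_add, Real.rpow_zero, smul_eq_mul] at hs
  have := neg_of_mul_neg_right hs (inv_pos.2 hs0).le
  linarith

theorem exists_forall_le_mul {g : ℝ → ℝ} {d a : ℝ} (hg : HasDerivWithinAt g d (Icc 0 1) 0)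
    (h0 : g 0 = 0) (hda : d < a) : ∃ δ > 0, ∀ y ∈ Icc (0 : ℝ) 1, y ≤ δ → g y ≤ a * y := by
  have hs := (hasDerivWithinAt_iff_tendsto_slope.1 hg).eventually_lt_const hda
  obtain ⟨ε, hε, hs⟩ := Metric.eventually_nhds_iff.1 (eventually_nhdsWithin_iff.1 hs)
  refine ⟨ε / 2, by positivity, fun y hy hyε => ?_⟩
  rcases hy.1.eq_or_lt with rfl | hy0
  · simp [h0]
  · have := hs (y := y) (by rw [Real.dist_eq, sub_zero, abs_of_pos hy0]; linarith)
      ⟨hy, hy0.ne'⟩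
    rw [slope_def_field, h0, sub_zero, sub_zero, div_lt_iff₀ hy0] at this
    exact this.le

/-- If `u` measures the distance to an end point that attracts on average, then the iterates of
points with small `u` are undecided only with small probability. -/
theorem exists_forall_measureReal_undecided_le {g₁ g₂ u : ℝ → ℝ}
    (hm₁ : MapsTo g₁ (Icc 0 1) (Icc 0 1)) (hm₂ : MapsTo g₂ (Icc 0 1) (Icc 0 1))
    (hu : ∀ y ∈ Icc (0 : ℝ) 1, 0 ≤ u y) {a₁ a₂ δ : ℝ} (ha₁ : 0 < a₁) (ha₂ : 0 < a₂)
    (ha : a₁ * a₂ < 1) (hδ : 0 < δ) (h₁ : ∀ y ∈ Icc (0 : ℝ) 1, u y ≤ δ → u (g₁ y) ≤ a₁ * u y)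
    (h₂ : ∀ y ∈ Icc (0 : ℝ) 1, u y ≤ δ → u (g₂ y) ≤ a₂ * u y)
    (hlim : ∀ v : ℕ → ℝ, Tendsto (fun n => u (v n)) atTop (𝓝 0) →
      Tendsto v atTop (𝓝 0) ∨ Tendsto v atTop (𝓝 1)) {η : ℝ} (hη : 0 < η) :
    ∃ ε > 0, ∀ y ∈ Icc (0 : ℝ) 1, u y < ε →
      (volume.restrict (Ioc 0 1)).real (undecided g₁ g₂ y) ≤ η := by
  obtain ⟨s, hs, hs2⟩ := exists_rpow_add_rpow_lt_two ha₁ ha₂ ha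
  set V : ℝ → ℝ≥0∞ := fun y => ENNReal.ofReal (u y ^ s) with hV
  have hVδ : ∀ y ∈ Icc (0 : ℝ) 1, V y ≤ ENNReal.ofReal (δ ^ s) → u y ≤ δ := by
    intro y hy h
    rw [ENNReal.ofReal_le_ofReal_iff (by positivity)] at h
    exact (Real.rpow_le_rpow_iff (hu y hy) hδ.le hs).1 h
  have hstep : ∀ (g : ℝ → ℝ) (a : ℝ), 0 < a → MapsTo g (Icc 0 1) (Icc 0 1) →
      (∀ y ∈ Icc (0 : ℝ) 1, u y ≤ δ → u (g y) ≤ a * u y) → ∀ y ∈ Icc (0 : ℝ) 1,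
      V y ≤ ENNReal.ofReal (δ ^ s) → V (g y) ≤ ENNReal.ofReal (a ^ s) * V y := by
    intro g a ha hm h y hy hVy
    rw [hV, ← ENNReal.ofReal_mul (by positivity), ← Real.mul_rpow ha.le (hu y hy)]
    exact ENNReal.ofReal_le_ofReal
      (Real.rpow_le_rpow (hu _ (hm hy)) (h y hy (hVδ y hy hVy)) hs.le)
  set C : ℝ≥0∞ := (1 - 2⁻¹ * (ENNReal.ofReal (a₁ ^ s) + ENNReal.ofReal (a₂ ^ s)))⁻¹ with hC
  -- Finiteness amounts to the mean weight being below one, which is how `s` was chosen.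
  have hCtop : C ≠ ∞ := by
    rw [hC, ENNReal.inv_ne_top, Ne, tsub_eq_zero_iff_le, not_le,
      ← ENNReal.ofReal_add (by positivity) (by positivity),
      show (2 : ℝ≥0∞)⁻¹ = ENNReal.ofReal 2⁻¹ by
        rw [ENNReal.ofReal_inv_of_pos (by norm_num)]; norm_num,
      ← ENNReal.ofReal_mul (by norm_num), ENNReal.ofReal_lt_one]
    linarith
  have hC0 : 0 ≤ C.toReal := ENNReal.toReal_nonneg
  have hδs : 0 < δ ^ s := Real.rpow_pos_of_pos hδ s
  -- Chosen so that `u y ^ s * C ≤ δ ^ s * η`; the `+ 1` keeps the denominator visibly positive.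
  refine ⟨(δ ^ s * η / (C.toReal + 1)) ^ s⁻¹, by positivity, fun y hy hyε => ?_⟩
  have hus : u y ^ s ≤ δ ^ s * η / (C.toReal + 1) := by
    have := Real.rpow_le_rpow (hu y hy) hyε.le hs.le
    rwa [← Real.rpow_mul (by positivity), inv_mul_cancel₀ hs.ne', Real.rpow_one] at this
  have hmain := mul_volume_not_tendsto_lyapunov_le hm₁ hm₂ (hstep g₁ a₁ ha₁ hm₁ h₁)
    (hstep g₂ a₂ ha₂ hm₂ h₂) hy
  have hit : ∀ x n, fiberIter g₁ g₂ n x y ∈ Icc (0 : ℝ) 1 := by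
    intro x n
    induction n with
    | zero => exact hy
    | succ n ih =>
      rw [fiberIter, fiberMap]
      split_ifs
      exacts [hm₁ ih, hm₂ ih]
  have hsub : undecided g₁ g₂ y ⊆
      {x | ¬ Tendsto (fun n => V (fiberIter g₁ g₂ n x y)) atTop (𝓝 0)} := by
    intro x hx hVx
    refine hx (hlim _ ?_)
    have h1 : Tendsto (fun n => u (fiberIter g₁ g₂ n x y) ^ s) atTop (𝓝 0) := by
      have := (ENNReal.tendsto_toReal ENNReal.zero_ne_top).comp hVx
      simp only [ENNReal.toReal_zero] at this
      refine this.congr fun n => ?_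
      exact ENNReal.toReal_ofReal (Real.rpow_nonneg (hu _ (hit x n)) s)
    have h2 := h1.rpow_const (p := s⁻¹) (Or.inr (inv_pos.2 hs).le)
    rw [Real.zero_rpow (inv_pos.2 hs).ne'] at h2
    refine h2.congr fun n => ?_
    rw [← Real.rpow_mul (hu _ (hit x n)), mul_inv_cancel₀ hs.ne', Real.rpow_one]
  have hle : ENNReal.ofReal (δ ^ s) * volume.restrict (Ioc 0 1) (undecided g₁ g₂ y) ≤ V y * C :=
    le_trans (by gcongr) hmain
  have hreal := ENNReal.toReal_mono (ENNReal.mul_ne_top ENNReal.ofReal_ne_top hCtop) hle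
  rw [ENNReal.toReal_mul, ENNReal.toReal_mul, ENNReal.toReal_ofReal hδs.le,
    ENNReal.toReal_ofReal (Real.rpow_nonneg (hu y hy) s), ← measureReal_def] at hreal
  have hfin : u y ^ s * C.toReal ≤ δ ^ s * η := by
    calc u y ^ s * C.toReal ≤ δ ^ s * η / (C.toReal + 1) * (C.toReal + 1) := by
          gcongr
          linarith
      _ = δ ^ s * η := by field_simp
  exact le_of_mul_le_mul_left (hreal.trans hfin) hδs

/-! ### Almost every base point decides a given fiber point -/

theorem IsIncreasingDiffeo.hasDerivWithinAt {g : ℝ → ℝ} (hg : IsIncreasingDiffeo g) {y : ℝ}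
    (hy : y ∈ Icc (0 : ℝ) 1) :
    HasDerivWithinAt g (derivWithin g (Icc 0 1) y) (Icc 0 1) y :=
  ((hg.contDiffOn.differentiableOn (by norm_num)) y hy).hasDerivWithinAt

/-- Two positive numbers with negative mean logarithm can be enlarged keeping the product below
one. -/
theorem exists_gt_mul_lt_one {c d : ℝ} (hc : 0 < c) (hd : 0 < d)
    (h : 1 / 2 * Real.log c + 1 / 2 * Real.log d < 0) :
    ∃ a b, c < a ∧ d < b ∧ a * b < 1 := by
  have hcd : c * d < 1 := by
    rw [← Real.log_neg_iff (by positivity), Real.log_mul hc.ne' hd.ne']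
    linarith
  have ht : Tendsto (fun t : ℝ => (c + t) * (d + t)) (𝓝[>] 0) (𝓝 (c * d)) := by
    have : Continuous fun t : ℝ => (c + t) * (d + t) := by fun_prop
    simpa using (this.tendsto 0).mono_left nhdsWithin_le_nhds
  obtain ⟨t, h1, h2⟩ := ((ht.eventually_lt_const hcd).and self_mem_nhdsWithin).exists
  exact ⟨c + t, d + t, by linarith, by linarith, h1⟩

theorem measureReal_undecided_eq_zero {β₁ β₂ : ℝ} {g₁ g₂ : ℝ → ℝ} (h : IsFiberPair β₁ β₂ g₁ g₂)
    (hβ : β₁ ≠ β₂) (hL0 : normalExponent g₁ g₂ 0 < 0) (hL1 : normalExponent g₁ g₂ 1 < 0)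
    {y : ℝ} (hy : y ∈ Icc (0 : ℝ) 1) :
    (volume.restrict (Ioc 0 1)).real (undecided g₁ g₂ y) = 0 := by
  have hm₁ := h.diffeo₁.bijOn.mapsTo
  have hm₂ := h.diffeo₂.bijOn.mapsTo
  have hc₁ := h.diffeo₁.contDiffOn.continuousOn
  have hc₂ := h.diffeo₂.contDiffOn.continuousOn
  have hI0 : (0 : ℝ) ∈ Icc (0 : ℝ) 1 := by simp
  have hI1 : (1 : ℝ) ∈ Icc (0 : ℝ) 1 := by simp
  have hend0 : ∀ η > 0, ∃ ε > 0, ∀ y ∈ Icc (0 : ℝ) 1, y < ε →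
      (volume.restrict (Ioc 0 1)).real (undecided g₁ g₂ y) ≤ η := by
    intro η hη
    have hd₁ := h.diffeo₁.derivWithin_pos 0 hI0
    have hd₂ := h.diffeo₂.derivWithin_pos 0 hI0
    obtain ⟨a₁, a₂, ha₁, ha₂, ha⟩ := exists_gt_mul_lt_one hd₁ hd₂ hL0
    obtain ⟨δ₁, hδ₁, h₁⟩ := exists_forall_le_mul (h.diffeo₁.hasDerivWithinAt hI0) h.zero₁ ha₁
    obtain ⟨δ₂, hδ₂, h₂⟩ := exists_forall_le_mul (h.diffeo₂.hasDerivWithinAt hI0) h.zero₂ ha₂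
    exact exists_forall_measureReal_undecided_le (u := fun y => y) hm₁ hm₂ (fun y hy => hy.1)
      (hd₁.trans ha₁) (hd₂.trans ha₂) ha (lt_min hδ₁ hδ₂)
      (fun y hy hyδ => h₁ y hy (hyδ.trans (min_le_left _ _)))
      (fun y hy hyδ => h₂ y hy (hyδ.trans (min_le_right _ _))) (fun v hv => Or.inl hv) hη
  have hrefl : MapsTo (fun z : ℝ => 1 - z) (Icc 0 1) (Icc 0 1) := fun z hz =>
    ⟨by linarith [hz.2], by linarith [hz.1]⟩
  -- Conjugation by `z ↦ 1 - z` moves the end `1` to `0` and keeps the multiplier.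
  have hderiv : ∀ g : ℝ → ℝ, IsIncreasingDiffeo g →
      HasDerivWithinAt (fun z => 1 - g (1 - z)) (derivWithin g (Icc 0 1) 1) (Icc 0 1) 0 := by
    intro g hg
    have h1 : HasDerivWithinAt (fun z : ℝ => 1 - z) (-1) (Icc 0 1) 0 := by
      simpa using ((hasDerivAt_id (0 : ℝ)).const_sub 1).hasDerivWithinAt
    have h2 := HasDerivWithinAt.comp (0 : ℝ) (h₂ := g) (h := fun z : ℝ => 1 - z)
      (by rw [sub_zero]; exact hg.hasDerivWithinAt hI1) h1 hrefl
    simpa using h2.const_sub 1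
  have hend1 : ∀ η > 0, ∃ ε > 0, ∀ y ∈ Icc (0 : ℝ) 1, 1 - y < ε →
      (volume.restrict (Ioc 0 1)).real (undecided g₁ g₂ y) ≤ η := by
    intro η hη
    have hd₁ := h.diffeo₁.derivWithin_pos 1 hI1
    have hd₂ := h.diffeo₂.derivWithin_pos 1 hI1
    obtain ⟨a₁, a₂, ha₁, ha₂, ha⟩ := exists_gt_mul_lt_one hd₁ hd₂ hL1
    obtain ⟨δ₁, hδ₁, h₁⟩ := exists_forall_le_mul (hderiv g₁ h.diffeo₁) (by simp [h.one₁]) ha₁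
    obtain ⟨δ₂, hδ₂, h₂⟩ := exists_forall_le_mul (hderiv g₂ h.diffeo₂) (by simp [h.one₂]) ha₂
    refine exists_forall_measureReal_undecided_le (u := fun y => 1 - y) hm₁ hm₂
      (fun y hy => by linarith [hy.2])
      (hd₁.trans ha₁) (hd₂.trans ha₂) ha (lt_min hδ₁ hδ₂)
      (fun y hy hyδ => ?_) (fun y hy hyδ => ?_) (fun v hv => Or.inr ?_) hη
    · simpa using h₁ (1 - y) (hrefl hy) (hyδ.trans (min_le_left _ _))
    · simpa using h₂ (1 - y) (hrefl hy) (hyδ.trans (min_le_right _ _))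
    · simpa using hv.const_sub 1
  have hreach₁ : ∀ ε > 0, ∀ y ∈ Icc (0 : ℝ) 1, y ≠ β₁ →
      ∃ n : ℕ, g₁^[n] y < ε ∨ 1 - ε < g₁^[n] y := by
    intro ε hε y hy hne
    rcases lt_or_gt_of_ne hne with hlt | hgt
    · obtain ⟨n, hn⟩ := exists_iterate_lt hm₁ hc₁ h.param₁.2.le h.lt₁ ⟨hy.1, hlt⟩ hε
      exact ⟨n, Or.inl hn⟩
    · obtain ⟨n, hn⟩ := exists_lt_iterate hm₁ hc₁ h.param₁.1.le h.gt₁ ⟨hgt, hy.2⟩ hε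
      exact ⟨n, Or.inr hn⟩
  -- Iterating `g₁` brings every point except `β₁` near an end; one application of `g₂` frees `β₁`.
  -- This is where `β₁ ≠ β₂` enters.
  have hmove : g₂ β₁ ≠ β₁ := by
    rcases lt_or_gt_of_ne hβ with hlt | hgt
    · exact (h.gt₂ _ h.param₁.1 hlt).ne'
    · exact (h.lt₂ _ hgt h.param₁.2).ne
  refine le_antisymm (nonpos_of_mean_value (g₁ := g₁) (g₂ := g₂)
    (h := fun y => (volume.restrict (Ioc 0 1)).real (undecided g₁ g₂ y)) hm₁ hm₂ hc₁ hc₂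
    (fun y => ?_) (measureReal_undecided g₁ g₂) (fun η hη => ?_) (fun ε hε y hy => ?_) y hy)
    measureReal_nonneg
  · refine (measureReal_mono (subset_univ _)).trans ?_
    simp [measureReal_def]
  · obtain ⟨ε₀, hε₀, h0⟩ := hend0 η hη
    obtain ⟨ε₁, hε₁, h1⟩ := hend1 η hη
    refine ⟨min ε₀ ε₁, lt_min hε₀ hε₁, fun y hy hyε => ?_⟩
    rcases hyε with hyε | hyε
    · exact h0 y hy (hyε.trans_le (min_le_left _ _))
    · exact h1 y hy (by linarith [min_le_right ε₀ ε₁])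
  · by_cases hyβ : y = β₁
    · subst hyβ
      obtain ⟨n, hn⟩ := hreach₁ ε hε _ (hm₂ hy) hmove
      exact ⟨n, 1, hn⟩
    · obtain ⟨n, hn⟩ := hreach₁ ε hε y hy hyβ
      exact ⟨n, 0, hn⟩

/-! ### The separating function -/

theorem IsFiberPair.monotoneOn_fiberIter {β₁ β₂ : ℝ} {g₁ g₂ : ℝ → ℝ}
    (h : IsFiberPair β₁ β₂ g₁ g₂) (n : ℕ) (x : ℝ) :
    MapsTo (fiberIter g₁ g₂ n x) (Icc 0 1) (Icc 0 1) ∧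
      MonotoneOn (fiberIter g₁ g₂ n x) (Icc 0 1) := by
  induction n with
  | zero => exact ⟨fun y hy => hy, fun y _ z _ hyz => hyz⟩
  | succ n ih =>
    have hmaps : MapsTo (fiberMap g₁ g₂ (doubling^[n] x)) (Icc 0 1) (Icc 0 1) := by
      unfold fiberMap
      split_ifs
      exacts [h.diffeo₁.bijOn.mapsTo, h.diffeo₂.bijOn.mapsTo]
    have hmono : MonotoneOn (fiberMap g₁ g₂ (doubling^[n] x)) (Icc 0 1) := by
      unfold fiberMap
      split_ifs
      exacts [h.diffeo₁.strictMonoOn.monotoneOn, h.diffeo₂.strictMonoOn.monotoneOn]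
    exact ⟨hmaps.comp ih.1, hmono.comp ih.2 ih.1⟩

open Classical in
/-- The supremum of the points of a dense sequence whose fiber iterates over `x` tend to `0`. -/
noncomputable def basinBoundary (g₁ g₂ : ℝ → ℝ) (x : unitInterval) : unitInterval :=
  ⨆ k : ℕ, if Tendsto (fun n => fiberIter g₁ g₂ n x (TopologicalSpace.denseSeq unitInterval k))
    atTop (𝓝 0) then TopologicalSpace.denseSeq unitInterval k else 0

theorem measurable_basinBoundary (g₁ g₂ : ℝ → ℝ) : Measurable (basinBoundary g₁ g₂) := by
  classical
  refine Measurable.iSup fun k => ?_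
  exact Measurable.ite (measurableSet_tendsto _ fun n =>
    (measurable_fiberIter g₁ g₂ n _).comp measurable_subtype_coe) measurable_const measurable_const

theorem separatesBasins_basinBoundary {β₁ β₂ : ℝ} {g₁ g₂ : ℝ → ℝ}
    (h : IsFiberPair β₁ β₂ g₁ g₂) (hβ : β₁ ≠ β₂) (hL0 : normalExponent g₁ g₂ 0 < 0)
    (hL1 : normalExponent g₁ g₂ 1 < 0) : SeparatesBasins g₁ g₂ (basinBoundary g₁ g₂) := by
  have hae : ∀ᵐ x : unitInterval, ∀ k : ℕ,
      (x : ℝ) ∉ undecided g₁ g₂ (TopologicalSpace.denseSeq unitInterval k) := by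
    rw [ae_all_iff]
    intro k
    have h0 := measureReal_undecided_eq_zero h hβ hL0 hL1
      (TopologicalSpace.denseSeq unitInterval k).2
    rw [measureReal_eq_zero_iff, Measure.restrict_congr_set Ioc_ae_eq_Icc] at h0
    have h1 : ∀ᵐ x ∂volume.restrict (Icc (0 : ℝ) 1),
        x ∉ undecided g₁ g₂ (TopologicalSpace.denseSeq unitInterval k) :=
      measure_eq_zero_iff_ae_notMem.1 h0
    exact (ae_restrict_iff_subtype measurableSet_Icc).1 h1
  classical
  filter_upwards [hae] with x hx y
  constructor
  · intro hy
    obtain ⟨k, hk⟩ := lt_iSup_iff.1 hy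
    split_ifs at hk with hlim
    · refine tendsto_of_tendsto_of_tendsto_of_le_of_le tendsto_const_nhds hlim
        (fun n => ((h.monotoneOn_fiberIter n x).1 y.2).1) fun n => ?_
      exact (h.monotoneOn_fiberIter n x).2 y.2 (Subtype.prop _) hk.le
    -- The default value `0` in the supremum cannot exceed `y`.
    · exact absurd hk (not_lt.2 y.2.1)
  · intro hy
    -- A dense point strictly between the boundary and `y` is decided but not attracted to `0`, so
    -- it tends to `1` and pushes `y` up.
    obtain ⟨z, ⟨hz1, hz2⟩, k, rfl⟩ :=
      (TopologicalSpace.denseRange_denseSeq unitInterval).exists_mem_open isOpen_Ioo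
        (nonempty_Ioo.2 hy) |> fun ⟨k, hk⟩ => (⟨_, hk, k, rfl⟩ :
          ∃ z, z ∈ Ioo _ _ ∧ ∃ k, TopologicalSpace.denseSeq unitInterval k = z)
    have hone : Tendsto (fun n => fiberIter g₁ g₂ n x
        (TopologicalSpace.denseSeq unitInterval k)) atTop (𝓝 1) := by
      rcases not_not.1 (hx k) with hlim | hlim
      · refine absurd (le_iSup (fun k : ℕ => if Tendsto (fun n => fiberIter g₁ g₂ n x
          (TopologicalSpace.denseSeq unitInterval k)) atTop (𝓝 0) then
            TopologicalSpace.denseSeq unitInterval k else 0) k) (not_le.2 ?_)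
        simp only [hlim, if_true]
        exact hz1
      · exact hlim
    refine tendsto_of_tendsto_of_tendsto_of_le_of_le hone tendsto_const_nhds (fun n => ?_)
      fun n => ((h.monotoneOn_fiberIter n x).1 y.2).2
    exact (h.monotoneOn_fiberIter n x).2 (Subtype.prop _) y.2 hz2.le

/-! ### The cubic family -/

theorem isIncreasingDiffeo_of_hasDerivAt {g g' : ℝ → ℝ} (hg : ContDiff ℝ 2 g)
    (hd : ∀ y, HasDerivAt g (g' y) y) (hpos : ∀ y ∈ Icc (0 : ℝ) 1, 0 < g' y) (h0 : g 0 = 0)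
    (h1 : g 1 = 1) : IsIncreasingDiffeo g := by
  have hmono : StrictMonoOn g (Icc 0 1) :=
    strictMonoOn_of_deriv_pos (convex_Icc 0 1) hg.continuous.continuousOn fun y hy => by
      rw [(hd y).deriv]
      exact hpos y (interior_subset hy)
  refine ⟨⟨fun y hy => ?_, hmono.injOn, ?_⟩, hmono, hg.contDiffOn, fun y hy => ?_⟩
  · have hI0 : (0 : ℝ) ∈ Icc (0 : ℝ) 1 := by simp
    have hI1 : (1 : ℝ) ∈ Icc (0 : ℝ) 1 := by simp
    exact ⟨h0 ▸ hmono.monotoneOn hI0 hy hy.1, h1 ▸ hmono.monotoneOn hy hI1 hy.2⟩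
  · simpa [SurjOn, h0, h1] using intermediate_value_Icc zero_le_one hg.continuous.continuousOn
  · rw [(hd y).hasDerivWithinAt.derivWithin (uniqueDiffOn_Icc_zero_one y hy)]
    exact hpos y hy

theorem hasDerivAt_cubic₁ (β y : ℝ) :
    HasDerivAt (cubic₁ β) (1 - β + 2 * (1 + β) * y - 3 * y ^ 2) y := by
  have h := (hasDerivAt_id y).add (((hasDerivAt_id y).mul ((hasDerivAt_id y).const_sub 1)).mul
    ((hasDerivAt_id y).sub_const β))
  refine h.congr_deriv ?_
  simp
  ring

theorem hasDerivAt_cubic₂ (β y : ℝ) :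
    HasDerivAt (cubic₂ β) (1 + β - 2 * (1 + β) * y + 3 * y ^ 2) y := by
  have h := (hasDerivAt_id y).sub (((hasDerivAt_id y).mul ((hasDerivAt_id y).const_sub 1)).mul
    ((hasDerivAt_id y).sub_const β))
  refine h.congr_deriv ?_
  simp
  ring

theorem isFiberPair_cubic {β₁ β₂ : ℝ} (h₁ : β₁ ∈ Ioo (0 : ℝ) 1) (h₂ : β₂ ∈ Ioo (0 : ℝ) 1) :
    IsFiberPair β₁ β₂ (cubic₁ β₁) (cubic₂ β₂) where
  param₁ := h₁
  param₂ := h₂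
  diffeo₁ := isIncreasingDiffeo_of_hasDerivAt (by unfold cubic₁; fun_prop)
    (hasDerivAt_cubic₁ β₁) (fun y hy => by
      -- The derivative is `(1 - β₁) * (1 - y) + β₁ * y + 3 * y * (1 - y)`.
      have h0 := mul_nonneg hy.1 (sub_nonneg.2 hy.2)
      have h1 := mul_nonneg h₁.1.le hy.1
      nlinarith [hy.1, hy.2, h₁.1, h₁.2]) (by simp [cubic₁]) (by simp [cubic₁])
  diffeo₂ := isIncreasingDiffeo_of_hasDerivAt (by unfold cubic₂; fun_prop)
    (hasDerivAt_cubic₂ β₂) (fun y hy => by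
      -- Completing the square: three times the derivative is `(3 * y - (1 + β₂)) ^ 2 + (1 + β₂) *
      -- (2 - β₂)`.
      have h0 : 0 < (1 + β₂) * (2 - β₂) := mul_pos (by linarith [h₂.1]) (by linarith [h₂.2])
      nlinarith [sq_nonneg (3 * y - (1 + β₂))]) (by simp [cubic₂]) (by simp [cubic₂])
  zero₁ := by simp [cubic₁]
  zero₂ := by simp [cubic₂]
  one₁ := by simp [cubic₁]
  one₂ := by simp [cubic₂]
  fixed₁ := by simp [cubic₁]
  fixed₂ := by simp [cubic₂]
  lt₁ y h0 h1 := by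
    have := mul_pos (mul_pos h0 (sub_pos.2 (h1.trans h₁.2))) (sub_pos.2 h1)
    unfold cubic₁
    linarith
  gt₁ y h0 h1 := by
    have := mul_pos (mul_pos (h₁.1.trans h0) (sub_pos.2 h1)) (sub_pos.2 h0)
    unfold cubic₁
    linarith
  gt₂ y h0 h1 := by
    have := mul_pos (mul_pos h0 (sub_pos.2 (h1.trans h₂.2))) (sub_pos.2 h1)
    unfold cubic₂
    linarith
  lt₂ y h0 h1 := by
    have := mul_pos (mul_pos (h₂.1.trans h0) (sub_pos.2 h1)) (sub_pos.2 h0)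
    unfold cubic₂
    linarith

theorem normalExponent_cubic_zero_neg {β₁ β₂ : ℝ} (h : (β₁, β₂) ∈ gammaS) :
    normalExponent (cubic₁ β₁) (cubic₂ β₂) 0 < 0 := by
  obtain ⟨⟨h1, h1'⟩, ⟨h2, h2'⟩, -, h3⟩ := h
  simp only at h1 h1' h2 h2' h3
  have hu := uniqueDiffOn_Icc_zero_one (0 : ℝ) (by simp)
  have hp : 0 < 1 - β₁ := by linarith
  rw [normalExponent, (hasDerivAt_cubic₁ β₁ 0).hasDerivWithinAt.derivWithin hu,
    (hasDerivAt_cubic₂ β₂ 0).hasDerivWithinAt.derivWithin hu, ← mul_add,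
    ← Real.log_mul (by linarith) (by linarith)]
  -- The upper bound on `β₂` in `gammaS` says exactly that the product of the multipliers at `0` is
  -- below one; the lower bound does the same at `1`.
  have hlt : (1 - β₁) * (1 + β₂) < 1 := by
    have : 1 + β₂ < 1 / (1 - β₁) := by linarith
    rwa [lt_div_iff₀' hp] at this
  have := Real.log_neg (mul_pos hp (by linarith : 0 < 1 + β₂)) hlt
  norm_num
  linarith

theorem normalExponent_cubic_one_neg {β₁ β₂ : ℝ} (h : (β₁, β₂) ∈ gammaS) :
    normalExponent (cubic₁ β₁) (cubic₂ β₂) 1 < 0 := by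
  obtain ⟨⟨h1, h1'⟩, ⟨h2, h2'⟩, h3, -⟩ := h
  simp only at h1 h1' h2 h2' h3
  have hu := uniqueDiffOn_Icc_zero_one (1 : ℝ) (by simp)
  rw [normalExponent, (hasDerivAt_cubic₁ β₁ 1).hasDerivWithinAt.derivWithin hu,
    (hasDerivAt_cubic₂ β₂ 1).hasDerivWithinAt.derivWithin hu, ← mul_add,
    show 1 - β₁ + 2 * (1 + β₁) * 1 - 3 * 1 ^ 2 = β₁ by ring,
    show 1 + β₂ - 2 * (1 + β₂) * 1 + 3 * 1 ^ 2 = 2 - β₂ by ring,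
    ← Real.log_mul (by linarith) (by linarith)]
  have hlt : β₁ * (2 - β₂) < 1 := by
    have : 2 - β₂ < 1 / β₁ := by linarith
    rwa [lt_div_iff₀' h1] at this
  have := Real.log_neg (mul_pos h1 (by linarith : 0 < 2 - β₂)) hlt
  linarith

end RandomWalkBoundary

theorem corollary4p5 :
    -- general fiber maps with negative normal Lyapunov exponents at 0 and 1
    (∀ (β₁ β₂ : ℝ) (g₁ g₂ : ℝ → ℝ), RandomWalkBoundary.IsFiberPair β₁ β₂ g₁ g₂ → β₁ ≠ β₂ →
      RandomWalkBoundary.normalExponent g₁ g₂ 0 < 0 →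
      RandomWalkBoundary.normalExponent g₁ g₂ 1 < 0 →
      ∃ Φ : unitInterval → unitInterval,
        Measurable Φ ∧ RandomWalkBoundary.SeparatesBasins g₁ g₂ Φ) ∧
    -- the cubic family with parameters in the region Γ_S
    (∀ β₁ β₂ : ℝ, (β₁, β₂) ∈ RandomWalkBoundary.gammaS → β₁ ≠ β₂ →
      ∃ Φ : unitInterval → unitInterval,
        Measurable Φ ∧ RandomWalkBoundary.SeparatesBasins
          (RandomWalkBoundary.cubic₁ β₁) (RandomWalkBoundary.cubic₂ β₂) Φ) := by
  refine ⟨fun β₁ β₂ g₁ g₂ h hβ hL0 hL1 => ⟨RandomWalkBoundary.basinBoundary g₁ g₂,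
    RandomWalkBoundary.measurable_basinBoundary g₁ g₂,
    RandomWalkBoundary.separatesBasins_basinBoundary h hβ hL0 hL1⟩, fun β₁ β₂ h hβ => ⟨_,
    RandomWalkBoundary.measurable_basinBoundary _ _,
    RandomWalkBoundary.separatesBasins_basinBoundary
      (RandomWalkBoundary.isFiberPair_cubic h.1 h.2.1) hβ
      (RandomWalkBoundary.normalExponent_cubic_zero_neg h)
      (RandomWalkBoundary.normalExponent_cubic_one_neg h)⟩⟩
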